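/- Let $G$ be a finite simple connected graph with $n \ge 9$ vertices. A vertex $v$ is a metamour of a vertex $w$ if the distance of $v$ and $w$ in $G$ equals $2$, and $G$ is called $2$-metamour-regular if every vertex of $G$ has exactly $2$ metamours. The following statements are equivalent: (a) $G$ is $2$-metamour-regular. (b) $G$ is either $2$-regular or $(n-3)$-regular. (c) $G$ is isomorphic either to the cycle graph $C_n$ or to a join $\overline{C_{n_1}} \mathbin{\nabla} \cdots \mathbin{\nabla} \overline{C_{n_t}}$ of complements of cycle graphs with $n = n_1 + \dots + n_t$ for some $t \ge 1$ and $n_i \ge 3$ for all $i \in \{1, \dots, t\}$. In (b) and in (c) the two alternatives exclude each other. Here the join of graphs is their disjoint union together with all edges between vertices of different graphs. -/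

import Mathlib

namespace SimpleGraph

/-- `v` is a metamour of `w` in `G` if the distance of `v` and `w` in `G` equals `2`. (Mathlib's
`dist` is `0` for vertices in different components, so the value `2` is always a genuine
distance.) -/
def IsMetamour {V : Type*} (G : SimpleGraph V) (v w : V) : Prop :=
  G.dist v w = 2

/-- `G` is `k`-metamour-regular if every vertex has exactly `k` metamours. -/
def IsMetamourRegular {V : Type*} (G : SimpleGraph V) (k : ℕ) : Prop :=
  ∀ v : V, {w : V | G.IsMetamour v w}.encard = k

/-- The (disjoint) join of a family of graphs: the disjoint union of the graphs `H i`, together with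
all edges between vertices of different members of the family. -/
def familyJoin {ι : Type*} {V : ι → Type*} (H : ∀ i, SimpleGraph (V i)) :
    SimpleGraph (Σ i, V i) where
  Adj x y := x.1 ≠ y.1 ∨ ∃ (i : ι) (a b : V i), x = ⟨i, a⟩ ∧ y = ⟨i, b⟩ ∧ (H i).Adj a b
  symm := by
    constructor
    rintro x y (h | ⟨i, a, b, hx, hy, h⟩)
    · exact Or.inl h.symm
    · exact Or.inr ⟨i, b, a, hy, hx, h.symm⟩
  loopless := by
    constructor
    rintro x (h | ⟨i, a, b, hx, hy, h⟩)
    · exact h rfl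
    · subst hx
      cases hy
      exact (H i).loopless.irrefl a h

/-- `G` is (isomorphic to) a join of the complements of `t ≥ 1` cycle graphs, each on at
least `3` vertices, and with `n` vertices in total. -/
def IsJoinOfCycleComplements {V : Type*} (G : SimpleGraph V) (n : ℕ) : Prop :=
  ∃ (t : ℕ) (m : Fin t → ℕ), 1 ≤ t ∧ (∀ i, 3 ≤ m i) ∧ n = ∑ i, m i ∧
    Nonempty (G ≃g familyJoin fun i => (cycleGraph (m i))ᶜ)

end SimpleGraph

/-! The crux is `card_le_eight`: a vertex of degree at least 3 with some vertex at distance 3 forces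
at most 8 vertices. So for n ≥ 9 a vertex of degree at least 3 sees everything within distance 2;
its non-neighbours are its two metamours and its degree is n - 3. Degrees of adjacent vertices
differ by at most 2, so large degree spreads over the connected graph. If no degree exceeds 2, the
two metamours of a vertex need different middle vertices, and the graph is 2-regular. Conversely, in
a cycle with at least 5 vertices the two vertices two steps away are distinct and are the metamours;
in an (n - 3)-regular graph neighbourhoods are too large for distance 3 to occur. For (c), a
connected 2-regular graph is a cycle. A graph is (n - 3)-regular iff its complement is 2-regular,
that is, a disjoint union of cycles, and complementing turns this union into a join. -/

namespace SimpleGraph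

/-! ### Cycle graphs and joins of their complements -/

/-- A bijective homomorphism between graphs in which all vertices have `d` neighbours, `d` finite
and nonzero, is an isomorphism. -/
theorem nonempty_iso_of_bijective_hom {W V : Type*} {H : SimpleGraph W} {G : SimpleGraph V}
    {d : ℕ} (hd : d ≠ 0) (hH : ∀ w, (H.neighborSet w).ncard = d)
    (hG : ∀ v, (G.neighborSet v).ncard = d) (f : H →g G) (hf : Function.Bijective f) :
    Nonempty (H ≃g G) := by
  refine ⟨⟨Equiv.ofBijective f hf, ?_⟩⟩
  intro a b
  refine ⟨fun h => ?_, fun h => f.map_adj h⟩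
  have himg : f '' H.neighborSet a = G.neighborSet (f a) := by
    -- Finiteness comes from `d ≠ 0`, since `ncard` is 0 on infinite sets.
    refine Set.eq_of_subset_of_ncard_le ?_ ?_ (Set.finite_of_ncard_ne_zero (by rw [hG]; exact hd))
    · rintro _ ⟨x, hx, rfl⟩
      exact f.map_adj hx
    · rw [Set.ncard_image_of_injective _ hf.1, hG, hH]
  have hb : f b ∈ f '' H.neighborSet a := by rw [himg]; exact h
  obtain ⟨x, hx, hxb⟩ := hb
  rw [← hf.1 hxb]
  exact hx

theorem ncard_neighborSet_cycleGraph {m : ℕ} (hm : 3 ≤ m) (a : Fin m) :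
    ((cycleGraph m).neighborSet a).ncard = 2 := by
  obtain ⟨k, rfl⟩ := Nat.exists_eq_add_of_le' hm
  rw [Set.ncard_eq_toFinset_card', ← neighborFinset_def, card_neighborFinset_eq_degree,
    cycleGraph_degree_three_le]

/-- The closed walk along a cycle, as a homomorphism from the cycle graph. -/
def Walk.cycleGraphHom {V : Type*} {G : SimpleGraph V} {v : V} (p : G.Walk v v) :
    cycleGraph p.length →g G where
  toFun i := p.getVert i
  map_rel' := by
    have key : ∀ a b : Fin p.length, (a - b).val = 1 → G.Adj (p.getVert a) (p.getVert b) := by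
      intro a b h
      have ha := a.isLt
      have hb := b.isLt
      rw [Fin.sub_def] at h
      simp only at h
      -- Subtraction in `Fin` wraps around: the last index is followed by 0, and the walk closes
      -- there.
      by_cases hab : b.val + 1 = p.length
      · have h0 : a.val = 0 := by
          have e : p.length - b.val = 1 := by omega
          rw [e] at h
          by_cases h1 : 1 + a.val < p.length
          · rw [Nat.mod_eq_of_lt h1] at h; omega
          · have : 1 + a.val = p.length := by omega
            rw [this, Nat.mod_self] at h; omega
        have hadj := p.adj_getVert_succ hb
        rw [hab, p.getVert_length] at hadj
        rw [h0, p.getVert_zero]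
        exact hadj.symm
      · have e : a.val = b.val + 1 := by
          by_cases h1 : p.length - b.val + a.val < p.length
          · rw [Nat.mod_eq_of_lt h1] at h; omega
          · rw [Nat.mod_eq_sub_mod (by omega), Nat.mod_eq_of_lt (by omega)] at h; omega
        rw [e]
        exact (p.adj_getVert_succ hb).symm
    intro a b hab
    rcases cycleGraph_adj'.1 hab with h | h
    · exact key a b h
    · exact (key b a h).symm

/-- A cycle through `v` fills its component, here the whole graph. Walking along it is a bijective
homomorphism between 2-regular graphs. -/
theorem Connected.nonempty_iso_cycleGraph {V : Type*} [Finite V] {G : SimpleGraph V}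
    (hc : G.Connected) (h2 : ∀ v, (G.neighborSet v).ncard = 2) :
    Nonempty (G ≃g cycleGraph (Nat.card V)) := by
  obtain ⟨v⟩ := hc.nonempty
  have hcyc : G.IsCycles := fun w _ => h2 w
  have hne : (G.neighborSet v).Nonempty := by
    rw [← Set.ncard_pos, h2]; norm_num
  obtain ⟨p, hp, hsupp⟩ := hcyc.exists_cycle_toSubgraph_verts_eq_connectedComponentSupp
    (c := G.connectedComponentMk v) (v := v) rfl hne
  have hmem : ∀ w, w ∈ p.support := fun w => by
    rw [← p.mem_verts_toSubgraph, hsupp]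
    exact ConnectedComponent.sound (hc.preconnected w v)
  have hbij : Function.Bijective p.cycleGraphHom := by
    constructor
    · intro a b hab
      have := hp.getVert_injOn' (by simp; omega) (by simp; omega) hab
      exact Fin.ext this
    · intro w
      obtain ⟨k, hk, hkl⟩ := Walk.mem_support_iff_exists_getVert.1 (hmem w)
      rcases hkl.lt_or_eq with h | h
      · exact ⟨⟨k, h⟩, hk⟩
      · refine ⟨⟨0, by have := hp.three_le_length; omega⟩, ?_⟩
        rw [h, p.getVert_length] at hk
        rw [← hk]
        exact p.getVert_zero
  obtain ⟨e⟩ := nonempty_iso_of_bijective_hom two_ne_zero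
    (ncard_neighborSet_cycleGraph hp.three_le_length) h2 _ hbij
  have hcard : p.length = Nat.card V := by
    rw [← Nat.card_congr e.toEquiv, Nat.card_fin]
  rw [← hcard]
  exact ⟨e.symm⟩

theorem familyJoin_adj_of_ne {ι : Type*} {V : ι → Type*} {H : ∀ i, SimpleGraph (V i)} {i j : ι}
    (h : i ≠ j) (a : V i) (b : V j) : (familyJoin H).Adj ⟨i, a⟩ ⟨j, b⟩ := Or.inl h

theorem familyJoin_adj_same {ι : Type*} {V : ι → Type*} {H : ∀ i, SimpleGraph (V i)} {i : ι}
    (a b : V i) : (familyJoin H).Adj ⟨i, a⟩ ⟨i, b⟩ ↔ (H i).Adj a b := by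
  constructor
  · rintro (h | ⟨j, a', b', ha, hb, h⟩)
    · exact absurd rfl h
    · cases ha
      cases hb
      exact h
  · intro h
    exact Or.inr ⟨i, a, b, rfl, rfl, h⟩

/-- Complementing the join removes all edges between members and restores each `H i`. -/
theorem neighborSet_compl_familyJoin_compl {ι : Type*} {V : ι → Type*}
    (H : ∀ i, SimpleGraph (V i)) (i : ι) (a : V i) :
    (familyJoin fun i => (H i)ᶜ)ᶜ.neighborSet ⟨i, a⟩ = Sigma.mk i '' (H i).neighborSet a := by
  ext ⟨j, b⟩
  by_cases hij : i = j
  · subst hij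
    simp only [mem_neighborSet, compl_adj, familyJoin_adj_same, Set.mem_image, Sigma.mk.injEq,
      true_and, heq_eq_eq, exists_eq_right, ne_eq]
    constructor
    · rintro ⟨h1, h2⟩
      by_contra h3
      exact h2 ⟨h1, h3⟩
    · exact fun h => ⟨h.ne, fun h' => h'.2 h⟩
  · simp only [mem_neighborSet, compl_adj, familyJoin_adj_of_ne hij, not_true, and_false, false_iff]
    rintro ⟨x, _, hx⟩
    exact hij (congrArg Sigma.fst hx)

theorem IsJoinOfCycleComplements.ncard_neighborSet_compl {V : Type*} {G : SimpleGraph V} {n : ℕ}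
    (h : G.IsJoinOfCycleComplements n) (v : V) : (Gᶜ.neighborSet v).ncard = 2 := by
  obtain ⟨t, m, -, hm, -, ⟨e⟩⟩ := h
  have himg : Gᶜ.neighborSet v = e ⁻¹' (familyJoin fun i => (cycleGraph (m i))ᶜ)ᶜ.neighborSet (e v) := by
    ext w
    simp [compl_adj, e.map_adj_iff]
  rw [himg, Set.ncard_preimage_of_injective_subset_range e.injective (by simp [e.surjective.range_eq])]
  obtain ⟨i, a⟩ := e v
  rw [neighborSet_compl_familyJoin_compl, Set.ncard_image_of_injective _ sigma_mk_injective,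
    ncard_neighborSet_cycleGraph (hm i)]

theorem ConnectedComponent.ncard_neighborSet_toSimpleGraph {V : Type*} {G : SimpleGraph V}
    (c : G.ConnectedComponent) (v : c) :
    (c.toSimpleGraph.neighborSet v).ncard = (G.neighborSet v).ncard := by
  rw [← Set.ncard_image_of_injective _ Subtype.val_injective]
  congr 1
  ext w
  constructor
  · rintro ⟨x, hx, rfl⟩
    exact hx
  · intro hw
    exact ⟨⟨w, c.mem_supp_of_adj_mem_supp v.2 hw⟩, hw, rfl⟩

/-- The components of `Gᶜ` are connected and 2-regular, hence cycles; vertices in different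
components are adjacent in `G`. -/
theorem isJoinOfCycleComplements_of_ncard_neighborSet_compl {V : Type*} [Finite V] [Nonempty V]
    {G : SimpleGraph V} (h2 : ∀ v, (Gᶜ.neighborSet v).ncard = 2) :
    G.IsJoinOfCycleComplements (Nat.card V) := by
  obtain ⟨t, ⟨σ⟩⟩ := Finite.exists_equiv_fin Gᶜ.ConnectedComponent
  let s : Fin t → Gᶜ.ConnectedComponent := σ.symm
  have hreg : ∀ (c : Gᶜ.ConnectedComponent) (v : c), (c.toSimpleGraph.neighborSet v).ncard = 2 :=
    fun c v => by rw [c.ncard_neighborSet_toSimpleGraph, h2]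
  let e : ∀ i, (s i).toSimpleGraph ≃g cycleGraph (Nat.card (s i)) := fun i =>
    ((s i).connected_toSimpleGraph.nonempty_iso_cycleGraph (hreg _)).some
  let f : (Σ i, Fin (Nat.card (s i))) → V := fun x => ((e x.1).symm x.2 : s x.1)
  have hs : ∀ i (x : s i), Gᶜ.connectedComponentMk x = s i := fun i x => x.2
  have hf : Function.Bijective f := by
    constructor
    · rintro ⟨i, a⟩ ⟨j, b⟩ hab
      have hij : i = j := by
        apply σ.symm.injective
        change s i = s j
        rw [← hs i ((e i).symm a), ← hs j ((e j).symm b)]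
        exact congrArg _ hab
      subst hij
      exact congrArg (Sigma.mk i) ((e i).symm.injective (Subtype.ext hab))
    · intro v
      have hv : Gᶜ.connectedComponentMk v = s (σ (Gᶜ.connectedComponentMk v)) :=
        (σ.symm_apply_apply _).symm
      exact ⟨⟨_, e _ ⟨v, hv⟩⟩, congrArg Subtype.val ((e _).symm_apply_apply ⟨v, hv⟩)⟩
  refine ⟨t, fun i => Nat.card (s i), ?_, fun i => ?_, ?_, ⟨Iso.symm ⟨Equiv.ofBijective f hf, ?_⟩⟩⟩
  · obtain ⟨v⟩ := ‹Nonempty V›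
    have := (σ (Gᶜ.connectedComponentMk v)).pos
    omega
  · obtain ⟨v⟩ := (s i).connected_toSimpleGraph.nonempty
    -- A vertex is not its own neighbour, so its component has more than 2 vertices.
    have hlt : ((s i).toSimpleGraph.neighborSet v).ncard < (Set.univ : Set (s i)).ncard :=
      Set.ncard_lt_ncard ⟨Set.subset_univ _, fun h => (s i).toSimpleGraph.irrefl (h (Set.mem_univ v))⟩
        Set.finite_univ
    rw [hreg, Set.ncard_univ] at hlt
    exact hlt
  · rw [← Nat.card_congr (Equiv.ofBijective f hf), Nat.card_sigma]
    simp
  · rintro ⟨i, a⟩ ⟨j, b⟩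
    change G.Adj (f ⟨i, a⟩) (f ⟨j, b⟩) ↔ _
    have hcompl : Gᶜ.Adj (f ⟨i, a⟩) (f ⟨j, b⟩) → i = j := fun h => by
      apply σ.symm.injective
      change s i = s j
      rw [← hs i ((e i).symm a), ← hs j ((e j).symm b)]
      exact ConnectedComponent.sound h.reachable
    by_cases hij : i = j
    · subst hij
      have h1 : Gᶜ.Adj (f ⟨i, a⟩) (f ⟨i, b⟩) ↔ (cycleGraph _).Adj a b := (e i).symm.map_adj_iff
      have h3 : f ⟨i, a⟩ = f ⟨i, b⟩ ↔ a = b := by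
        rw [hf.1.eq_iff]
        simp
      rw [familyJoin_adj_same, compl_adj, ← h1, compl_adj]
      constructor
      · intro h
        exact ⟨fun hab => h.ne (h3.2 hab), fun h' => h'.2 h⟩
      · rintro ⟨h4, h5⟩
        by_contra h6
        exact h5 ⟨fun h' => h4 (h3.1 h'), h6⟩
    · refine iff_of_true ?_ (Or.inl hij)
      by_contra h
      exact hij (hcompl ⟨fun h' => hij (congrArg Sigma.fst (hf.1 h')), h⟩)

end SimpleGraph

/-! ### Distance spheres and metamours -/

namespace SimpleGraph

variable {V : Type*} {G : SimpleGraph V}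

theorem Connected.exists_adj_dist_eq (hc : G.Connected) {v w : V} {k : ℕ}
    (h : G.dist v w = k + 1) : ∃ x, G.dist v x = k ∧ G.Adj x w := by
  obtain ⟨p, hp⟩ := hc.exists_walk_length_eq_dist v w
  have hlen : p.length = k + 1 := hp.trans h
  have hadj := p.adj_getVert_succ (i := k) (by omega)
  rw [← hlen, p.getVert_length] at hadj
  refine ⟨p.getVert k, le_antisymm ?_ ?_, hadj⟩
  · refine (dist_le (p.take k)).trans ?_
    simp
  · have := hc.dist_triangle (u := v) (v := p.getVert k) (w := w)
    rw [dist_eq_one_iff_adj.2 hadj] at this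
    omega

theorem Connected.dist_le_succ_of_adj (hc : G.Connected) {v x w : V} (h : G.Adj x w) :
    G.dist v w ≤ G.dist v x + 1 := by
  have := hc.dist_triangle (u := v) (v := x) (w := w)
  rwa [dist_eq_one_iff_adj.2 h] at this

theorem dist_eq_two_of_adj_of_adj {x y z : V} (h1 : G.Adj x y) (h2 : G.Adj y z) (hne : x ≠ z)
    (hadj : ¬ G.Adj x z) : G.dist x z = 2 := by
  refine le_antisymm (dist_le (Walk.cons h1 (Walk.cons h2 Walk.nil))) ?_
  exact (h1.reachable.trans h2.reachable).one_lt_dist_of_ne_of_not_adj hne hadj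

theorem Connected.exists_adj_adj_of_dist_eq_two (hc : G.Connected) {x z : V}
    (h : G.dist x z = 2) : ∃ y, G.Adj x y ∧ G.Adj y z := by
  obtain ⟨y, hy, hyz⟩ := hc.exists_adj_dist_eq h
  exact ⟨y, dist_eq_one_iff_adj.1 hy, hyz⟩

theorem not_adj_of_dist_eq_two {x z : V} (h : G.dist x z = 2) : ¬ G.Adj x z := fun h' => by
  rw [dist_eq_one_iff_adj.2 h'] at h
  omega

theorem ne_of_dist_eq_two {x z : V} (h : G.dist x z = 2) : x ≠ z := by
  rintro rfl
  simp at h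

variable [Fintype V]

open Classical in
/-- The finite set of vertices at distance `k` from `v`. -/
noncomputable def distSphere (G : SimpleGraph V) (v : V) (k : ℕ) : Finset V :=
  Finset.univ.filter fun w => G.dist v w = k

@[simp] theorem mem_distSphere {v w : V} {k : ℕ} : w ∈ G.distSphere v k ↔ G.dist v w = k := by
  simp [distSphere]

theorem card_distSphere_one [DecidableRel G.Adj] (v : V) :
    (G.distSphere v 1).card = G.degree v := by
  rw [← card_neighborFinset_eq_degree]
  congr 1
  ext w
  simp

theorem Connected.card_distSphere_zero (hc : G.Connected) (v : V) :
    (G.distSphere v 0).card = 1 := by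
  rw [Finset.card_eq_one]
  refine ⟨v, ?_⟩
  ext w
  simp [hc.dist_eq_zero_iff, eq_comm]

/-- A geodesic meets every intermediate distance, so an empty sphere leaves nothing beyond it. -/
theorem Connected.card_le_sum_card_distSphere (hc : G.Connected) {v : V} {k : ℕ}
    (h : ∀ w, G.dist v w ≠ k) :
    Fintype.card V ≤ ∑ i ∈ Finset.range k, (G.distSphere v i).card := by
  classical
  have hlt : ∀ j w, G.dist v w ≠ k + j := by
    intro j
    induction j with
    | zero => exact h
    | succ j ih =>
      intro w hw
      obtain ⟨x, hx, -⟩ := hc.exists_adj_dist_eq (k := k + j) hw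
      exact ih x hx
  rw [← Finset.card_univ]
  refine (Finset.card_le_card ?_).trans Finset.card_biUnion_le
  intro w _
  simp only [Finset.mem_biUnion, Finset.mem_range, mem_distSphere, exists_eq_right']
  by_contra hw
  exact hlt (G.dist v w - k) w (by omega)

theorem isMetamourRegular_iff_card_distSphere {k : ℕ} :
    G.IsMetamourRegular k ↔ ∀ v, (G.distSphere v 2).card = k := by
  refine forall_congr' fun v => ?_
  have : {w | G.IsMetamour v w} = (G.distSphere v 2 : Set V) := by
    ext w
    simp [IsMetamour]
  rw [this, Set.encard_coe_eq_coe_finsetCard]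
  norm_cast

namespace IsMetamourRegular

variable (h : G.IsMetamourRegular 2)
include h

theorem card_le_two {S : Finset V} {x : V} (hS : ∀ y ∈ S, G.dist x y = 2) : S.card ≤ 2 := by
  rw [← isMetamourRegular_iff_card_distSphere.1 h x]
  exact Finset.card_le_card fun y hy => mem_distSphere.2 (hS y hy)

theorem eq_or_eq {x p q r : V} (hpq : p ≠ q) (hp : G.dist x p = 2) (hq : G.dist x q = 2)
    (hr : G.dist x r = 2) : r = p ∨ r = q := by
  classical
  by_contra! hne
  have := h.card_le_two (S := {p, q, r}) (x := x) (by simp [hp, hq, hr])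
  rw [Finset.card_eq_three.2 ⟨p, q, r, hpq, hne.1.symm, hne.2.symm, rfl⟩] at this
  omega

end IsMetamourRegular
end SimpleGraph

/-! ### A vertex of degree at least 3 with a vertex at distance 3 -/

namespace SimpleGraph

variable {V : Type*} {G : SimpleGraph V}

theorem Connected.dist_eq_two_of_dist_eq_add_two (hc : G.Connected) {v x y z : V} (h1 : G.Adj x y)
    (h2 : G.Adj y z) (h : G.dist v z = G.dist v x + 2) : G.dist x z = 2 := by
  refine dist_eq_two_of_adj_of_adj h1 h2 ?_ fun h3 => ?_
  · rintro rfl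
    omega
  · have := hc.dist_le_succ_of_adj (v := v) h3
    omega

theorem Connected.dist_eq_two_of_dist_eq_three (hc : G.Connected) {v u a c : V} (hvu : G.Adj v u)
    (hua : G.Adj u a) (hac : G.Adj a c) (hvc : G.dist v c = 3) : G.dist u c = 2 :=
  hc.dist_eq_two_of_dist_eq_add_two hua hac (by rw [hvc, dist_eq_one_iff_adj.2 hvu])

variable [Fintype V]

namespace IsMetamourRegular

variable (h : G.IsMetamourRegular 2) (hc : G.Connected)
include h hc

/-- Suppose that `v`, `u`, `a`, `c` is a geodesic, that `u'` is another common neighbour of `v` and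
`a`, and that `q` is a neighbour of `v` adjacent to none of `u`, `u'`, `a`. Then `c` is the only
vertex at distance `3` from `v`. -/
theorem eq_of_dist_eq_three_of_not_adj {v u u' q a c x : V} (huu' : u ≠ u') (hvu : G.Adj v u)
    (hvu' : G.Adj v u') (hvq : G.Adj v q) (hua : G.Adj u a) (hu'a : G.Adj u' a)
    (hqa : ¬ G.Adj q a) (hqu : ¬ G.Adj q u) (hqu' : ¬ G.Adj q u') (hac : G.Adj a c)
    (hvc : G.dist v c = 3) (hvx : G.dist v x = 3) : x = c := by
  by_contra hxc
  have hqu2 : G.dist q u = 2 := dist_eq_two_of_adj_of_adj hvq.symm hvu (by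
    rintro rfl; exact hqa hua) hqu
  have hqu'2 : G.dist q u' = 2 := dist_eq_two_of_adj_of_adj hvq.symm hvu' (by
    rintro rfl; exact hqa hu'a) hqu'
  have huc : G.dist u c = 2 := hc.dist_eq_two_of_dist_eq_three hvu hua hac hvc
  have hu'c : G.dist u' c = 2 := hc.dist_eq_two_of_dist_eq_three hvu' hu'a hac hvc
  have hne1 : ∀ {y z : V}, G.Adj v y → 2 ≤ G.dist v z → z ≠ y := by
    rintro y z hy hz rfl
    rw [dist_eq_one_iff_adj.2 hy] at hz
    omega
  have hSu : ∀ y, G.dist u y = 2 → y = c ∨ y = q := fun y hy =>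
    h.eq_or_eq (hne1 hvq (by omega)) huc (by rwa [dist_comm]) hy
  have hSu' : ∀ y, G.dist u' y = 2 → y = c ∨ y = q := fun y hy =>
    h.eq_or_eq (hne1 hvq (by omega)) hu'c (by rwa [dist_comm]) hy
  have hSq : ∀ y, G.dist q y = 2 → y = u ∨ y = u' := fun y hy => h.eq_or_eq huu' hqu2 hqu'2 hy
  have hxq : x ≠ q := hne1 hvq (by omega)
  -- All metamours of `u`, `u'` and `q` are now known. A geodesic `v`, `y`, `b`, `x` makes `b` a
  -- further metamour of `u`.
  obtain ⟨b, hvb, hbx⟩ := hc.exists_adj_dist_eq hvx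
  have hbu : ¬ G.Adj u b := fun hub => by
    rcases hSu x (hc.dist_eq_two_of_dist_eq_three hvu hub hbx hvx) with h1 | h1
    exacts [hxc h1, hxq h1]
  have hbu' : ¬ G.Adj u' b := fun hub => by
    rcases hSu' x (hc.dist_eq_two_of_dist_eq_three hvu' hub hbx hvx) with h1 | h1
    exacts [hxc h1, hxq h1]
  obtain ⟨y, hvy, hyb⟩ := hc.exists_adj_adj_of_dist_eq_two hvb
  have hyq : y ≠ q := by
    rintro rfl
    rcases hSq x (hc.dist_eq_two_of_dist_eq_three hvy hyb hbx hvx) with h1 | h1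
    exacts [hne1 hvu (by omega) h1, hne1 hvu' (by omega) h1]
  have huy : G.Adj u y := by
    by_contra huy
    rcases hSu y (dist_eq_two_of_adj_of_adj hvu.symm hvy (by rintro rfl; exact hbu hyb) huy)
      with h1 | h1
    exacts [hne1 hvy (by omega) h1.symm, hyq h1]
  rcases hSu b (dist_eq_two_of_adj_of_adj huy hyb (hne1 hvu (by omega)).symm hbu) with h1 | h1
  · rw [h1] at hvb; omega
  · exact hne1 hvq (by omega) h1

/-- If `a` lies at distance `2` from `v` and has two neighbours at distance `3` from `v`, then all
vertices at distance `3` from `v` are neighbours of `a`. -/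
theorem adj_of_dist_eq_three {v a c c' x : V} (hcc' : c ≠ c') (hva : G.dist v a = 2)
    (hac : G.Adj a c) (hac' : G.Adj a c') (hvc : G.dist v c = 3) (hvc' : G.dist v c' = 3)
    (hvx : G.dist v x = 3) : G.Adj a x := by
  by_contra hax
  obtain ⟨u, hvu, hua⟩ := hc.exists_adj_adj_of_dist_eq_two hva
  have hSu : ∀ y, G.dist u y = 2 → G.dist v y = 3 ∧ G.Adj a y := fun y hy => by
    rcases h.eq_or_eq hcc' (hc.dist_eq_two_of_dist_eq_three hvu hua hac hvc)
      (hc.dist_eq_two_of_dist_eq_three hvu hua hac' hvc') hy with rfl | rfl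
    exacts [⟨hvc, hac⟩, ⟨hvc', hac'⟩]
  obtain ⟨b, hvb, hbx⟩ := hc.exists_adj_dist_eq hvx
  have hub : ¬ G.Adj u b := fun hub =>
    hax (hSu x (hc.dist_eq_two_of_dist_eq_three hvu hub hbx hvx)).2
  obtain ⟨y, hvy, hyb⟩ := hc.exists_adj_adj_of_dist_eq_two hvb
  -- The metamours of `u` are `c` and `c'`, both at distance 3 from `v`, so neither `y` nor `b` can
  -- be one.
  have huy : G.Adj u y := by
    by_contra huy
    have := (hSu y (dist_eq_two_of_adj_of_adj hvu.symm hvy (by rintro rfl; exact hub hyb) huy)).1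
    rw [dist_eq_one_iff_adj.2 hvy] at this
    omega
  have := (hSu b (dist_eq_two_of_adj_of_adj huy hyb (by
    rintro rfl
    rw [dist_eq_one_iff_adj.2 hvu] at hvb
    omega) hub)).1
  omega

/-- Either some `a` at distance 2 has two neighbours in the sphere, which then consists of metamours
of a single `u`, or choosing predecessors injects it into the 2-element sphere of radius 2. -/
theorem card_distSphere_three_le (v : V) : (G.distSphere v 3).card ≤ 2 := by
  classical
  by_cases hex : ∃ a c c', c ≠ c' ∧ G.dist v a = 2 ∧ G.Adj a c ∧ G.Adj a c' ∧
      G.dist v c = 3 ∧ G.dist v c' = 3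
  · obtain ⟨a, c, c', hcc', hva, hac, hac', hvc, hvc'⟩ := hex
    obtain ⟨u, hvu, hua⟩ := hc.exists_adj_adj_of_dist_eq_two hva
    refine h.card_le_two (x := u) fun y hy => ?_
    rw [mem_distSphere] at hy
    exact hc.dist_eq_two_of_dist_eq_three hvu hua
      (h.adj_of_dist_eq_three hc hcc' hva hac hac' hvc hvc' hy) hy
  · push Not at hex
    choose! f hf using fun x (hx : G.dist v x = 3) => hc.exists_adj_dist_eq (k := 2) hx
    rw [← isMetamourRegular_iff_card_distSphere.1 h v]
    refine Finset.card_le_card_of_injOn f (fun x hx => ?_) fun x hx y hy hxy => ?_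
    · simp only [Finset.mem_coe, mem_distSphere] at hx ⊢
      exact (hf x hx).1
    · simp only [Finset.mem_coe, mem_distSphere] at hx hy
      by_contra hne
      exact hex (f x) x y hne (hf x hx).1 (hf x hx).2 (by rw [hxy]; exact (hf y hy).2) hx hy

/-- Along a geodesic `v`, `·`, `a`, `c`, the neighbours of `v` are at most two neighbours of `a`, the
vertices of `P`, and at most one vertex that is adjacent neither to `a` nor to a common neighbour of
`v` and `a`. -/
theorem degree_le_and_exists [DecidableRel G.Adj] {v a c : V} (hva : G.dist v a = 2)
    (hac : G.Adj a c) (hvc : G.dist v c = 3) (P : Finset V)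
    (hP : ∀ x u, G.Adj v x → ¬ G.Adj x a → G.Adj v u → G.Adj u a → G.Adj x u → x ∈ P) :
    G.degree v ≤ 3 + P.card ∧ (G.degree v = 3 + P.card → ∃ u u' q, u ≠ u' ∧ G.Adj v u ∧
      G.Adj v u' ∧ G.Adj v q ∧ G.Adj u a ∧ G.Adj u' a ∧ ¬ G.Adj q a ∧ ¬ G.Adj q u ∧
      ¬ G.Adj q u') := by
  classical
  let N := (G.neighborFinset v).filter fun x => G.Adj x a
  let Q := (G.neighborFinset v).filter fun x =>
    ¬ G.Adj x a ∧ ∀ u, G.Adj v u → G.Adj u a → ¬ G.Adj x u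
  have hN : ∀ {x}, x ∈ N ↔ G.Adj v x ∧ G.Adj x a := by simp [N]
  have hQ : ∀ {x}, x ∈ Q ↔ G.Adj v x ∧ ¬ G.Adj x a ∧ ∀ u, G.Adj v u → G.Adj u a → ¬ G.Adj x u := by
    simp [Q]
  have hsub : G.neighborFinset v ⊆ N ∪ P ∪ Q := by
    intro x hx
    rw [mem_neighborFinset] at hx
    simp only [Finset.mem_union, hN, hQ]
    by_cases hxa : G.Adj x a
    · exact Or.inl (Or.inl ⟨hx, hxa⟩)
    · by_cases hxu : ∃ u, G.Adj v u ∧ G.Adj u a ∧ G.Adj x u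
      · obtain ⟨u, h1, h2, h3⟩ := hxu
        exact Or.inl (Or.inr (hP x u hx hxa h1 h2 h3))
      · push Not at hxu
        exact Or.inr ⟨hx, hxa, hxu⟩
  have hcard : G.degree v ≤ N.card + P.card + Q.card := by
    rw [← card_neighborFinset_eq_degree]
    exact (Finset.card_le_card hsub).trans ((Finset.card_union_le _ _).trans
      (Nat.add_le_add_right (Finset.card_union_le _ _) _))
  -- Every vertex of `N` is a metamour of `c`.
  have hN2 : N.card ≤ 2 := h.card_le_two (x := c) fun u hu => by
    rw [dist_comm]
    exact hc.dist_eq_two_of_dist_eq_three (hN.1 hu).1 (hN.1 hu).2 hac hvc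
  -- A common neighbour `u` of `v` and `a` has `c` and all of `Q` as metamours.
  have hQ1 : Q.card ≤ 1 := by
    obtain ⟨u, hvu, hua⟩ := hc.exists_adj_adj_of_dist_eq_two hva
    have hcQ : c ∉ Q := fun hcQ => by
      rw [dist_eq_one_iff_adj.2 (hQ.1 hcQ).1] at hvc
      omega
    have := h.card_le_two (S := insert c Q) (x := u) fun y hy => by
      rcases Finset.mem_insert.1 hy with rfl | hy
      · exact hc.dist_eq_two_of_dist_eq_three hvu hua hac hvc
      · obtain ⟨hvy, hya, hyu⟩ := hQ.1 hy
        exact dist_eq_two_of_adj_of_adj hvu.symm hvy (by rintro rfl; exact hya hua)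
          fun h' => hyu u hvu hua h'.symm
    rw [Finset.card_insert_of_notMem hcQ] at this
    omega
  refine ⟨by omega, fun hd => ?_⟩
  obtain ⟨u, u', huu', hNe⟩ := Finset.card_eq_two.1 (show N.card = 2 by omega)
  obtain ⟨q, hq⟩ := Finset.card_pos.1 (show 0 < Q.card by omega)
  have hu := hN.1 (show u ∈ N by simp [hNe])
  have hu' := hN.1 (show u' ∈ N by simp [hNe])
  obtain ⟨hvq, hqa, hqu⟩ := hQ.1 hq
  exact ⟨u, u', q, huu', hu.1, hu'.1, hvq, hu.2, hu'.2, hqa, hqu u hu.1 hu.2, hqu u' hu'.1 hu'.2⟩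

/-- Sphere sizes add up to at most 1+3+2+1+1 if distance 4 occurs, and otherwise to 1+4+2+1 or
1+3+2+2. -/
theorem card_le_eight [DecidableRel G.Adj] {v w : V} (hw : G.dist v w = 3)
    (hd : 3 ≤ G.degree v) : Fintype.card V ≤ 8 := by
  classical
  have h0 := hc.card_distSphere_zero v
  have h1 := card_distSphere_one (G := G) v
  have h2 := isMetamourRegular_iff_card_distSphere.1 h v
  have h3 := h.card_distSphere_three_le hc v
  by_cases h4 : ∃ e, G.dist v e = 4
  · obtain ⟨e, hve⟩ := h4
    obtain ⟨c, hvc, hce⟩ := hc.exists_adj_dist_eq hve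
    obtain ⟨a, hva, hac⟩ := hc.exists_adj_dist_eq hvc
    have hae : G.dist a e = 2 := hc.dist_eq_two_of_dist_eq_add_two hac hce (by rw [hva, hve])
    have hne : v ≠ e := by
      rintro rfl
      simp at hve
    -- A vertex of `P` would be a third metamour of `a`, besides `v` and `e`.
    obtain ⟨hle, hex⟩ := h.degree_le_and_exists hc hva hac hvc ∅ fun x u hvx hxa _ hua hxu => by
      have hxa' : G.dist x a = 2 := dist_eq_two_of_adj_of_adj hxu hua (by
        rintro rfl
        rw [dist_eq_one_iff_adj.2 hvx] at hva
        omega) hxa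
      rw [dist_comm] at hva hxa'
      rcases h.eq_or_eq hne hva hae hxa' with rfl | rfl
      · exact (hvx.ne rfl).elim
      · rw [dist_eq_one_iff_adj.2 hvx] at hve
        omega
    rw [Finset.card_empty] at hle hex
    obtain ⟨u, u', q, huu', hvu, hvu', hvq, hua, hu'a, hqa, hqu, hqu'⟩ := hex (by omega)
    have hL3 : ∀ x, G.dist v x = 3 → x = c := fun x hx =>
      h.eq_of_dist_eq_three_of_not_adj hc huu' hvu hvu' hvq hua hu'a hqa hqu hqu' hac hvc hx
    have hL4 : ∀ x, G.dist v x = 4 → x = e := fun x hx => by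
      obtain ⟨c', hc', hc'x⟩ := hc.exists_adj_dist_eq hx
      rw [hL3 c' hc'] at hc'x
      have hax : G.dist a x = 2 := hc.dist_eq_two_of_dist_eq_add_two hac hc'x (by rw [hva, hx])
      rcases h.eq_or_eq hne (by rwa [dist_comm]) hae hax with rfl | rfl
      · simp at hx
      · rfl
    -- Such an `x` would be a third metamour of `c`, besides `u` and `u'`.
    have hL5 : ∀ x, G.dist v x ≠ 5 := fun x hx => by
      obtain ⟨e', he', he'x⟩ := hc.exists_adj_dist_eq hx
      rw [hL4 e' he'] at he'x
      have hcx : G.dist c x = 2 := hc.dist_eq_two_of_dist_eq_add_two hce he'x (by rw [hvc, hx])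
      have hcu := hc.dist_eq_two_of_dist_eq_three hvu hua hac hvc
      have hcu' := hc.dist_eq_two_of_dist_eq_three hvu' hu'a hac hvc
      rw [dist_comm] at hcu hcu'
      rcases h.eq_or_eq huu' hcu hcu' hcx with rfl | rfl
      · rw [dist_eq_one_iff_adj.2 hvu] at hx
        omega
      · rw [dist_eq_one_iff_adj.2 hvu'] at hx
        omega
    have h3' : (G.distSphere v 3).card ≤ 1 := Finset.card_le_one_iff.2 fun hx hy => by
      rw [mem_distSphere] at hx hy
      rw [hL3 _ hx, hL3 _ hy]
    have h4' : (G.distSphere v 4).card ≤ 1 := Finset.card_le_one_iff.2 fun hx hy => by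
      rw [mem_distSphere] at hx hy
      rw [hL4 _ hx, hL4 _ hy]
    have := hc.card_le_sum_card_distSphere hL5
    simp only [Finset.sum_range_succ, Finset.sum_range_zero] at this
    omega
  · push Not at h4
    have hsum := hc.card_le_sum_card_distSphere h4
    simp only [Finset.sum_range_succ, Finset.sum_range_zero] at hsum
    obtain ⟨a, hva, haw⟩ := hc.exists_adj_dist_eq hw
    -- Without `e`, one metamour of `a` other than `v` remains possible.
    let P := (G.distSphere a 2).erase v
    have hPc : P.card = 1 := by
      rw [Finset.card_erase_of_mem (by rwa [mem_distSphere, dist_comm]),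
        isMetamourRegular_iff_card_distSphere.1 h a]
    obtain ⟨hle, hex⟩ := h.degree_le_and_exists hc hva haw hw P fun x u hvx hxa _ hua hxu => by
      simp only [P, Finset.mem_erase, mem_distSphere]
      refine ⟨hvx.ne', ?_⟩
      rw [dist_comm]
      refine dist_eq_two_of_adj_of_adj hxu hua ?_ hxa
      rintro rfl
      rw [dist_eq_one_iff_adj.2 hvx] at hva
      omega
    rw [hPc] at hle hex
    by_cases hd4 : G.degree v = 4
    · obtain ⟨u, u', q, huu', hvu, hvu', hvq, hua, hu'a, hqa, hqu, hqu'⟩ := hex (by omega)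
      have hL3 : ∀ x, G.dist v x = 3 → x = w := fun x hx =>
        h.eq_of_dist_eq_three_of_not_adj hc huu' hvu hvu' hvq hua hu'a hqa hqu hqu' haw hw hx
      have h3' : (G.distSphere v 3).card ≤ 1 := Finset.card_le_one_iff.2 fun hx hy => by
        rw [mem_distSphere] at hx hy
        rw [hL3 _ hx, hL3 _ hy]
      omega
    · omega

end IsMetamourRegular
end SimpleGraph

/-! ### Degrees and the equivalences -/

namespace SimpleGraph

variable {V : Type*} {G : SimpleGraph V}

theorem Connected.mem_of_forall_adj (hc : G.Connected) {S : Set V} {v : V} (hv : v ∈ S)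
    (hS : ∀ x ∈ S, ∀ y, G.Adj x y → y ∈ S) (w : V) : w ∈ S := by
  obtain ⟨p⟩ := hc.preconnected v w
  induction p with
  | nil => exact hv
  | cons hadj _ ih => exact ih (hS _ hv _ hadj)

variable [Fintype V]

theorem degree_add_ncard_neighborSet_compl [DecidableRel G.Adj] (v : V) :
    G.degree v + (Gᶜ.neighborSet v).ncard + 1 = Fintype.card V := by
  classical
  have h1 : (Gᶜ.neighborSet v).ncard = Gᶜ.degree v := by
    rw [Set.ncard_eq_toFinset_card', ← neighborFinset_def, card_neighborFinset_eq_degree]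
  have h2 := G.degree_lt_card_verts v
  rw [h1, degree_compl]
  omega

theorem isRegularOfDegree_iff_ncard_neighborSet [DecidableRel G.Adj] {d : ℕ} :
    G.IsRegularOfDegree d ↔ ∀ v, (G.neighborSet v).ncard = d := by
  refine forall_congr' fun v => ?_
  rw [Set.ncard_eq_toFinset_card', ← neighborFinset_def, card_neighborFinset_eq_degree]

theorem degree_eq_sub_three_iff [DecidableRel G.Adj] (hn : 3 ≤ Fintype.card V) (v : V) :
    G.degree v = Fintype.card V - 3 ↔ (Gᶜ.neighborSet v).ncard = 2 := by
  have := G.degree_add_ncard_neighborSet_compl v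
  omega

theorem Connected.ncard_neighborSet_compl_eq (hc : G.Connected) {v : V}
    (h3 : ∀ w, G.dist v w ≠ 3) : (Gᶜ.neighborSet v).ncard = (G.distSphere v 2).card := by
  rw [← Set.ncard_coe_finset]
  congr 1
  ext w
  simp only [mem_neighborSet, compl_adj, Finset.mem_coe, mem_distSphere]
  refine ⟨fun ⟨hne, hadj⟩ => ?_, fun h => ⟨ne_of_dist_eq_two h, not_adj_of_dist_eq_two h⟩⟩
  by_contra hw
  have hlt := hc.one_lt_dist_of_ne_of_not_adj hne hadj
  have hfar : ∀ j x, G.dist v x ≠ 3 + j := by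
    intro j
    induction j with
    | zero => exact h3
    | succ j ih =>
      intro x hx
      obtain ⟨y, hy, -⟩ := hc.exists_adj_dist_eq (k := 3 + j) hx
      exact ih y hy
  exact hfar (G.dist v w - 3) w (by omega)

theorem exists_forall_adj_iff_of_degree_eq_two [DecidableRel G.Adj] {x y : V}
    (hx : G.degree x = 2) (hxy : G.Adj x y) : ∃ z, z ≠ y ∧ ∀ t, G.Adj x t ↔ t = y ∨ t = z := by
  classical
  rw [← card_neighborFinset_eq_degree, Finset.card_eq_two] at hx
  obtain ⟨p, q, hpq, hN⟩ := hx
  have hadj : ∀ t, G.Adj x t ↔ t = p ∨ t = q := fun t => by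
    rw [← mem_neighborFinset, hN]
    simp
  rcases (hadj y).1 hxy with rfl | rfl
  · exact ⟨q, hpq.symm, hadj⟩
  · exact ⟨p, hpq, fun t => (hadj t).trans or_comm⟩

theorem IsRegularOfDegree.isMetamourRegular_two [DecidableRel G.Adj]
    (h2 : G.IsRegularOfDegree 2) (hc : G.Connected) (hn : 5 ≤ Fintype.card V) :
    G.IsMetamourRegular 2 := by
  classical
  rw [isMetamourRegular_iff_card_distSphere]
  intro v
  -- By connectedness a closed set containing `v` is everything; this excludes triangles and
  -- 4-cycles through `v`.
  have hsmall : ∀ S : Finset V, v ∈ S → S.card ≤ 4 →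
      ¬ ∀ x ∈ S, ∀ y, G.Adj x y → y ∈ S := fun S hv hS hclosed => by
    have huniv : S = Finset.univ :=
      Finset.eq_univ_of_forall (hc.mem_of_forall_adj (S := (S : Set V)) hv hclosed)
    rw [huniv, Finset.card_univ] at hS
    omega
  obtain ⟨u, hvu⟩ := (G.degree_pos_iff_exists_adj v).1 (by rw [h2 v]; norm_num)
  obtain ⟨w, hwu, hv⟩ := exists_forall_adj_iff_of_degree_eq_two (h2 v) hvu
  have hvw : G.Adj v w := (hv w).2 (Or.inr rfl)
  obtain ⟨u', hu'v, hu⟩ := exists_forall_adj_iff_of_degree_eq_two (h2 u) hvu.symm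
  obtain ⟨w', hw'v, hw⟩ := exists_forall_adj_iff_of_degree_eq_two (h2 w) hvw.symm
  have huu' : G.Adj u u' := (hu u').2 (Or.inr rfl)
  have hww' : G.Adj w w' := (hw w').2 (Or.inr rfl)
  have huw : ¬ G.Adj u w := fun huw => by
    have e1 : u' = w := (((hu w).1 huw).resolve_left hvw.ne').symm
    have e2 : w' = u := (((hw u).1 huw.symm).resolve_left hvu.ne').symm
    refine hsmall {v, u, w} (by simp) (Finset.card_le_three.trans (by norm_num)) ?_
    intro x hx y hxy
    simp only [Finset.mem_insert, Finset.mem_singleton] at hx ⊢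
    rcases hx with rfl | rfl | rfl
    · have := (hv y).1 hxy
      tauto
    · have := (hu y).1 hxy
      rw [e1] at this
      tauto
    · have := (hw y).1 hxy
      rw [e2] at this
      tauto
  have hne : u' ≠ w' := by
    intro e
    subst e
    obtain ⟨z, hz, hu'z⟩ := exists_forall_adj_iff_of_degree_eq_two (h2 u') huu'.symm
    have e1 : z = w := (((hu'z w).1 hww'.symm).resolve_left hwu).symm
    refine hsmall {v, u, w, u'} (by simp) Finset.card_le_four ?_
    intro x hx y hxy
    simp only [Finset.mem_insert, Finset.mem_singleton] at hx ⊢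
    rcases hx with rfl | rfl | rfl | rfl
    · have := (hv y).1 hxy
      tauto
    · have := (hu y).1 hxy
      tauto
    · have := (hw y).1 hxy
      tauto
    · have := (hu'z y).1 hxy
      rw [e1] at this
      tauto
  have hvu' : ¬ G.Adj v u' := fun h' => by
    rcases (hv u').1 h' with rfl | rfl
    exacts [huu'.ne rfl, huw huu']
  have hvw' : ¬ G.Adj v w' := fun h' => by
    rcases (hv w').1 h' with rfl | rfl
    exacts [huw hww'.symm, hww'.ne rfl]
  rw [Finset.card_eq_two]
  refine ⟨u', w', hne, ?_⟩
  ext y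
  simp only [mem_distSphere, Finset.mem_insert, Finset.mem_singleton]
  constructor
  · intro hy
    obtain ⟨x, hvx, hxy⟩ := hc.exists_adj_adj_of_dist_eq_two hy
    rcases (hv x).1 hvx with rfl | rfl
    · exact Or.inl (((hu y).1 hxy).resolve_left (ne_of_dist_eq_two hy).symm)
    · exact Or.inr (((hw y).1 hxy).resolve_left (ne_of_dist_eq_two hy).symm)
  · rintro (rfl | rfl)
    · exact dist_eq_two_of_adj_of_adj hvu huu' hu'v.symm hvu'
    · exact dist_eq_two_of_adj_of_adj hvw hww' hw'v.symm hvw'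

/-- Vertices at distance 3 have disjoint neighbourhoods, giving 2(n - 3) + 2 ≤ n, so n ≤ 4. -/
theorem Connected.isMetamourRegular_two_of_ncard_neighborSet_compl (hc : G.Connected)
    (hn : 5 ≤ Fintype.card V) (h2 : ∀ v, (Gᶜ.neighborSet v).ncard = 2) :
    G.IsMetamourRegular 2 := by
  classical
  rw [isMetamourRegular_iff_card_distSphere]
  intro v
  refine (hc.ncard_neighborSet_compl_eq ?_).symm.trans (h2 v)
  intro w hw
  have hne : w ≠ v := by
    rintro rfl
    simp at hw
  have hlt : ((G.neighborFinset v ∪ G.neighborFinset w) ∪ {v, w}).card ≤ Fintype.card V :=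
    Finset.card_le_univ _
  have hdisj : Disjoint (G.neighborFinset v) (G.neighborFinset w) := by
    rw [Finset.disjoint_left]
    intro x hvx hwx
    rw [mem_neighborFinset] at hvx hwx
    have := dist_le (Walk.cons hvx (Walk.cons hwx.symm Walk.nil))
    rw [hw] at this
    simp at this
  have hvw : ¬ G.Adj v w := fun h' => by
    rw [dist_eq_one_iff_adj.2 h'] at hw
    omega
  have hdisj' : Disjoint (G.neighborFinset v ∪ G.neighborFinset w) {v, w} := by
    simp [G.adj_comm w v, hvw]
  rw [Finset.card_union_of_disjoint hdisj', Finset.card_union_of_disjoint hdisj,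
    Finset.card_pair hne.symm, card_neighborFinset_eq_degree, card_neighborFinset_eq_degree] at hlt
  have hdv := G.degree_add_ncard_neighborSet_compl v
  have hdw := G.degree_add_ncard_neighborSet_compl w
  rw [h2] at hdv hdw
  omega

namespace IsMetamourRegular

variable (h : G.IsMetamourRegular 2) (hc : G.Connected)
include h

/-- Any other neighbour of `v` is a neighbour or a metamour of `u`. -/
theorem degree_le_degree_add_two [DecidableRel G.Adj] {u v : V} (huv : G.Adj u v) :
    G.degree v ≤ G.degree u + 2 := by
  classical
  have hsub : (G.neighborFinset v).erase u ⊆ (G.neighborFinset u).erase v ∪ G.distSphere u 2 := by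
    intro x hx
    rw [Finset.mem_erase, mem_neighborFinset] at hx
    rw [Finset.mem_union, Finset.mem_erase, mem_neighborFinset, mem_distSphere]
    by_cases hux : G.Adj u x
    · exact Or.inl ⟨hx.2.ne', hux⟩
    · exact Or.inr (dist_eq_two_of_adj_of_adj huv hx.2 hx.1.symm hux)
  have := (Finset.card_le_card hsub).trans (Finset.card_union_le _ _)
  rw [Finset.card_erase_of_mem (by simpa using huv.symm),
    Finset.card_erase_of_mem (by simpa using huv), card_neighborFinset_eq_degree,
    card_neighborFinset_eq_degree, isMetamourRegular_iff_card_distSphere.1 h u] at this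
  have hv : 0 < G.degree v := (G.degree_pos_iff_exists_adj v).2 ⟨u, huv.symm⟩
  have hu : 0 < G.degree u := (G.degree_pos_iff_exists_adj u).2 ⟨v, huv⟩
  omega

include hc

/-- A common middle vertex towards both metamours would have degree at least 3. -/
theorem two_le_degree [DecidableRel G.Adj] (hd : ∀ v, G.degree v ≤ 2) (v : V) :
    2 ≤ G.degree v := by
  classical
  obtain ⟨p, q, hpq, hS⟩ := Finset.card_eq_two.1 (isMetamourRegular_iff_card_distSphere.1 h v)
  have hp : G.dist v p = 2 := by rw [← mem_distSphere, hS]; simp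
  have hq : G.dist v q = 2 := by rw [← mem_distSphere, hS]; simp
  obtain ⟨x, hvx, hxp⟩ := hc.exists_adj_adj_of_dist_eq_two hp
  obtain ⟨y, hvy, hyq⟩ := hc.exists_adj_adj_of_dist_eq_two hq
  have hxy : x ≠ y := by
    rintro rfl
    have hsub : {v, p, q} ⊆ G.neighborFinset x := by
      intro z hz
      simp only [Finset.mem_insert, Finset.mem_singleton] at hz
      rw [mem_neighborFinset]
      rcases hz with rfl | rfl | rfl
      exacts [hvx.symm, hxp, hyq]
    have hle := Finset.card_le_card hsub
    rw [card_neighborFinset_eq_degree, Finset.card_eq_three.2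
      ⟨v, p, q, ne_of_dist_eq_two hp, ne_of_dist_eq_two hq, hpq, rfl⟩] at hle
    have := hd x
    omega
  rw [← Finset.card_pair hxy, ← card_neighborFinset_eq_degree]
  refine Finset.card_le_card fun z hz => ?_
  simp only [Finset.mem_insert, Finset.mem_singleton] at hz
  rw [mem_neighborFinset]
  rcases hz with rfl | rfl
  exacts [hvx, hvy]

theorem isRegularOfDegree [DecidableRel G.Adj] (hn : 9 ≤ Fintype.card V) :
    G.IsRegularOfDegree 2 ∨ G.IsRegularOfDegree (Fintype.card V - 3) := by
  by_cases hd : ∀ v, G.degree v ≤ 2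
  · exact Or.inl fun v => le_antisymm (hd v) (h.two_le_degree hc hd v)
  · push Not at hd
    obtain ⟨v, hv⟩ := hd
    have hbig : ∀ x, 3 ≤ G.degree x → G.degree x = Fintype.card V - 3 := fun x hx => by
      rw [degree_eq_sub_three_iff (by omega), hc.ncard_neighborSet_compl_eq,
        isMetamourRegular_iff_card_distSphere.1 h]
      intro w hw
      have := h.card_le_eight hc hw hx
      omega
    refine Or.inr fun w => hbig w ?_
    -- A neighbour of a vertex of degree n - 3 has degree at least n - 5 ≥ 4.
    refine hc.mem_of_forall_adj (S := {x | 3 ≤ G.degree x}) (v := v) hv (fun x hx y hxy => ?_) w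
    have h1 := hbig x hx
    have h2 := h.degree_le_degree_add_two hxy.symm
    change 3 ≤ G.degree y
    omega

end IsMetamourRegular
end SimpleGraph

theorem mainTheorem4 {V : Type*} [Fintype V] (G : SimpleGraph V) [DecidableRel G.Adj] (n : ℕ)
    (hcard : Fintype.card V = n) (hn : 9 ≤ n) (hG : G.Connected) :
    (G.IsMetamourRegular 2 ↔ G.IsRegularOfDegree 2 ∨ G.IsRegularOfDegree (n - 3)) ∧
    (G.IsMetamourRegular 2 ↔
      Nonempty (G ≃g SimpleGraph.cycleGraph n) ∨ G.IsJoinOfCycleComplements n) ∧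
    ¬ (G.IsRegularOfDegree 2 ∧ G.IsRegularOfDegree (n - 3)) ∧
    ¬ (Nonempty (G ≃g SimpleGraph.cycleGraph n) ∧ G.IsJoinOfCycleComplements n) := by
  subst hcard
  have := hG.nonempty
  have hreg : G.IsRegularOfDegree (Fintype.card V - 3) ↔ ∀ v, (Gᶜ.neighborSet v).ncard = 2 :=
    forall_congr' fun v => SimpleGraph.degree_eq_sub_three_iff (by omega) v
  have hcyc : G.IsRegularOfDegree 2 ↔ Nonempty (G ≃g SimpleGraph.cycleGraph (Fintype.card V)) := by
    rw [SimpleGraph.isRegularOfDegree_iff_ncard_neighborSet]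
    constructor
    · intro h2
      rw [← Nat.card_eq_fintype_card]
      exact hG.nonempty_iso_cycleGraph h2
    · rintro ⟨e⟩ v
      rw [← SimpleGraph.ncard_neighborSet_cycleGraph (by omega) (e v), ← Nat.card_coe_set_eq,
        ← Nat.card_coe_set_eq]
      exact Nat.card_congr (e.mapNeighborSet v)
  have hjoin : G.IsRegularOfDegree (Fintype.card V - 3) ↔
      G.IsJoinOfCycleComplements (Fintype.card V) := by
    rw [hreg]
    refine ⟨fun h2 => ?_, fun h => h.ncard_neighborSet_compl⟩
    rw [← Nat.card_eq_fintype_card]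
    exact SimpleGraph.isJoinOfCycleComplements_of_ncard_neighborSet_compl h2
  have hmain : G.IsMetamourRegular 2 ↔
      G.IsRegularOfDegree 2 ∨ G.IsRegularOfDegree (Fintype.card V - 3) := by
    refine ⟨fun h => h.isRegularOfDegree hG hn, ?_⟩
    rintro (h2 | h2)
    · exact h2.isMetamourRegular_two hG (by omega)
    · exact hG.isMetamourRegular_two_of_ncard_neighborSet_compl (by omega) (hreg.1 h2)
  have hexcl : ¬ (G.IsRegularOfDegree 2 ∧ G.IsRegularOfDegree (Fintype.card V - 3)) := by
    rintro ⟨h1, h2⟩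
    obtain ⟨v⟩ := this
    have := (h1 v).symm.trans (h2 v)
    omega
  exact ⟨hmain, by rw [hmain, hcyc, hjoin], hexcl, by rwa [← hcyc, ← hjoin]⟩
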